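/- Let $\mathbb{F}$ be a field and let $A, B \in \mathbb{F}^{n\times n}$. For $S,T\subseteq[n]=\{1,\dots,n\}$ write $A[S,T]$ for the submatrix of $A$ with rows indexed by $S$ and columns indexed by $T$, write $A[S]=A[S,S]$, and let $\overline{X}=[n]\setminus X$. Say that $A$ *satisfies property $\mathcal{R}$* if (1) all off-diagonal entries of $A$ are nonzero, and (2) for any four distinct indices $i,j,k,\ell\in[n]$ with $\operatorname{rank} A[\{i,j\},\{k,\ell\}]=1$ there is a set $X\subseteq[n]$ with $i,j\in X$, $k,\ell\in\overline{X}$ and $\operatorname{rank} A[X,\overline{X}]=1$. A set $X\subseteq[n]$ is a *cut* of $A$ if $2\le |X|\le n-2$ and both $A[X,\overline{X}]$ and $A[\overline{X},X]$ have rank at most one. The matrices $A$ and $B$ are *principal minor equivalent* if $\det A[S]=\det B[S]$ for all $S\subseteq[n]$. **Theorem.** Suppose that $A$ satisfies property $\mathcal{R}$ and has no cut. Then $A$ and $B$ are principal minor equivalent if and only if $\det A[S]=\det B[S]$ for all $S\subseteq[n]$ with $|S|\le 4$. -/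

import Mathlib

namespace PrincipalMinors

variable {ι F : Type*} [Fintype ι] [DecidableEq ι] [Field F]

/-- `A[S, T]`: the submatrix of `A` with rows indexed by `S` and columns indexed by `T`. -/
def sub (A : Matrix ι ι F) (S T : Finset ι) : Matrix S T F :=
  A.submatrix (fun i : S => (i : ι)) (fun j : T => (j : ι))

/-- All off-diagonal entries are nonzero. -/
def IsDense (A : Matrix ι ι F) : Prop :=
  ∀ i j, i ≠ j → A i j ≠ 0

/-- Whenever `A[{i,j}, {k,l}]` has rank one for four distinct indices, this extends to
a rank-one block `A[X, Xᶜ]` with `i, j ∈ X` and `k, l ∈ Xᶜ`. -/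
def RankOneExtension (A : Matrix ι ι F) : Prop :=
  ∀ i j k l : ι, [i, j, k, l].Nodup → (sub A {i, j} {k, l}).rank = 1 →
    ∃ X : Finset ι, i ∈ X ∧ j ∈ X ∧ k ∈ Xᶜ ∧ l ∈ Xᶜ ∧ (sub A X Xᶜ).rank = 1

def PropertyR (A : Matrix ι ι F) : Prop :=
  IsDense A ∧ RankOneExtension A

/-- `X` is a cut of the `n × n` matrix `A`: `2 ≤ |X| ≤ n - 2` and both off-diagonal blocks
`A[X, Xᶜ]` and `A[Xᶜ, X]` have rank at most one. -/
def IsCut (A : Matrix ι ι F) (X : Finset ι) : Prop :=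
  2 ≤ X.card ∧ X.card + 2 ≤ Fintype.card ι ∧
    (sub A X Xᶜ).rank ≤ 1 ∧ (sub A Xᶜ X).rank ≤ 1

/-- Principal minor equivalence. -/
def PME (A B : Matrix ι ι F) : Prop :=
  ∀ S : Finset ι, (sub A S S).det = (sub B S S).det

/-- Equality of corresponding principal minors of order at most `k`. -/
def PMEUpTo (k : ℕ) (A B : Matrix ι ι F) : Prop :=
  ∀ S : Finset ι, S.card ≤ k → (sub A S S).det = (sub B S S).det

end PrincipalMinors

/-!
Write `B[i, j, k]` for the cyclic product `B i j * B j k * B k i`. The minors of order at most three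
determine the sum and the product of `B[i, j, k]` and `B[i, k, j]`, so on each triple of indices `B`
has the cyclic products either of `A` or of `Aᵀ`; this colours the triples on which the two differ.
If all triples have the same colour, then `B` is diagonally similar to `A` or to `Aᵀ`.

Otherwise two triples of different colours have two common indices, and the minor of order four on
their union shows that these four indices are split into two pairs like a cut. Starting from such
a mixed split `{i, j} | {k, l}`, replace `i` or `j` by an index `m` for which `{i, j} | {k, m}` is
not a split. The only obstruction is a pentagon, five indices in cyclic order each of whose
neighbour pairs is split from the two remaining indices. There the two blocks of `A` attached to an
index extend differently, and the difference alternates around the cycle, which has odd length. The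
indices reached by replacements then form one side of a cut of `A`.

Only ratios of entries occur in the splits, so that part is written additively, for the entries as
elements of the additive group of units.
-/

namespace PrincipalMinors

section Splits

variable {ι G : Type*} [AddCommGroup G]

/-- For an additively written matrix `a`, the block with rows `i, j` and columns `k, l` has rank
one, i.e. its `2 × 2` minor vanishes. -/
def IsRankOne (a : ι → ι → G) (i j k l : ι) : Prop := a i k + a j l = a i l + a j k

/-- Both off-diagonal blocks for the partition `{i, j} | {k, l}` have rank one: the local form of
a cut. -/
def IsSplit (a : ι → ι → G) (i j k l : ι) : Prop := IsRankOne a i j k l ∧ IsRankOne a k l i j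

/-- The additive form of the quotient of the two cyclic products on `i, j, k`. It is an
alternating cocycle. -/
def skew (a : ι → ι → G) (i j k : ι) : G := a i j + a j k + a k i - (a j i + a k j + a i k)

/-- Rank-one `2 × 2` blocks extend to any further index, either as a row or as a column. -/
def RankOneExtends (a : ι → ι → G) : Prop :=
  ∀ i j k l m, i ≠ k → i ≠ l → j ≠ k → j ≠ l →
    IsRankOne a i j k l → IsRankOne a i m k l ∨ IsRankOne a i j k m

variable {a : ι → ι → G} {i j k l m : ι}

lemma skew_rotate (i j k : ι) : skew a j k i = skew a i j k := by unfold skew; abel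

lemma skew_swap (i j k : ι) : skew a j i k = -skew a i j k := by unfold skew; abel

lemma skew_cocycle (i j k l : ι) :
    skew a i j k + skew a i k l = skew a i j l + skew a j k l := by unfold skew; abel

lemma skew_eq_iff (i j k l : ι) :
    skew a i j k = skew a i j l ↔ skew a i k l = skew a j k l := by
  have := skew_cocycle (a := a) i j k l
  grind

lemma pairwise_ne_of_skew_ne_zero (h : skew a i j k ≠ 0) : i ≠ j ∧ i ≠ k ∧ j ≠ k := by
  refine ⟨?_, ?_, ?_⟩ <;> rintro rfl <;> exact h (by unfold skew; abel)

lemma IsRankOne.swap_left (h : IsRankOne a i j k l) : IsRankOne a j i k l := by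
  unfold IsRankOne at *; rw [add_comm, ← h, add_comm]

lemma IsRankOne.swap_right (h : IsRankOne a i j k l) : IsRankOne a i j l k := Eq.symm h

lemma IsRankOne.trans_left (h : IsRankOne a i j k l) (h' : IsRankOne a i m k l) :
    IsRankOne a j m k l := by
  unfold IsRankOne at *; grind

lemma IsRankOne.trans_right (h : IsRankOne a i j k l) (h' : IsRankOne a i j k m) :
    IsRankOne a i j l m := by
  unfold IsRankOne at *; grind

lemma isRankOne_self_left (i k l : ι) : IsRankOne a i i k l := add_comm _ _

lemma isRankOne_self_right (i j k : ι) : IsRankOne a i j k k := rfl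

lemma isRankOne_comm_of_skew_eq (h : skew a i j k = skew a i j l) :
    IsRankOne a i j k l ↔ IsRankOne a k l i j := by
  unfold IsRankOne; unfold skew at h
  constructor <;> intro h' <;> grind

namespace IsSplit

lemma symm (h : IsSplit a i j k l) : IsSplit a k l i j := And.symm h

lemma swap_left (h : IsSplit a i j k l) : IsSplit a j i k l := ⟨h.1.swap_left, h.2.swap_right⟩

lemma swap_right (h : IsSplit a i j k l) : IsSplit a i j l k := ⟨h.1.swap_right, h.2.swap_left⟩

lemma trans_left (h : IsSplit a i j k l) (h' : IsSplit a i m k l) : IsSplit a j m k l :=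
  ⟨h.1.trans_left h'.1, h.2.trans_right h'.2⟩

lemma trans_right (h : IsSplit a i j k l) (h' : IsSplit a i j k m) : IsSplit a i j l m :=
  ⟨h.1.trans_right h'.1, h.2.trans_left h'.2⟩

lemma self_left (i k l : ι) : IsSplit a i i k l :=
  ⟨isRankOne_self_left .., isRankOne_self_right ..⟩

lemma self_right (i j k : ι) : IsSplit a i j k k :=
  ⟨isRankOne_self_right .., isRankOne_self_left ..⟩

lemma skew_congr_right (h : IsSplit a i j k l) : skew a i j k = skew a i j l := by
  unfold IsSplit IsRankOne at h; unfold skew; grind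

lemma skew_congr_left (h : IsSplit a i j k l) : skew a i k l = skew a j k l :=
  (skew_eq_iff ..).1 h.skew_congr_right

/-- Subtracting the rank-one relations of two crossing splits expresses the minor with rows
`i, j` and columns `k, m` through `skew a i j k`. -/
lemma skew_eq_zero_of_isRankOne (h₁ : IsSplit a i k j m) (h₂ : IsSplit a j k i m)
    (h : IsRankOne a i j k m ∨ IsRankOne a k m i j) : skew a i j k = 0 := by
  unfold IsSplit IsRankOne at *; unfold skew
  grind

end IsSplit

/-- The extensions of the two blocks of a split might attach `m` to different sides; the
equivalence `hm` prevents this. -/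
lemma RankOneExtends.isSplit_or (hE : RankOneExtends a) (h : IsSplit a i j k l)
    (hik : i ≠ k) (hil : i ≠ l) (hjk : j ≠ k) (hjl : j ≠ l)
    (hm : IsRankOne a i j k m ↔ IsRankOne a k m i j) :
    IsSplit a i m k l ∨ IsSplit a i j k m := by
  have rows := hE i j k l m hik hil hjk hjl h.1
  have columns := hE k l i j m hik.symm hjk.symm hil.symm hjl.symm h.2
  unfold IsSplit
  tauto

/-- Five indices in cyclic order such that, for each of them, its two neighbours are split from
the two remaining indices. The nonvanishing of `skew` keeps the indices apart. -/
structure Pentagon (a : ι → ι → G) (u v w x y : ι) : Prop where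
  skew_ne_zero : skew a u v w ≠ 0
  split_uv : IsSplit a u v w y
  split_vw : IsSplit a v w x u
  split_wx : IsSplit a w x y v
  split_xy : IsSplit a x y u w
  split_yu : IsSplit a y u v x

namespace Pentagon

variable {u v w x y : ι}

lemma skew_eq_of_consecutive (h : Pentagon a u v w x y) :
    skew a v w x = skew a u v w ∧ skew a w x y = skew a u v w ∧
      skew a x y u = skew a u v w ∧ skew a y u v = skew a u v w := by
  have r := @skew_rotate ι G _ a
  have := h.split_uv.skew_congr_right
  have := h.split_vw.skew_congr_right
  have := h.split_wx.skew_congr_right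
  have := h.split_xy.skew_congr_right
  grind

lemma skew_eq_of_nonconsecutive (h : Pentagon a u v w x y) :
    skew a v w y = skew a u v x ∧ skew a w x u = skew a u v x ∧
      skew a x y v = skew a u v x ∧ skew a y u w = skew a u v x := by
  have r := @skew_rotate ι G _ a
  have := h.split_uv.skew_congr_left
  have := h.split_vw.skew_congr_left
  have := h.split_wx.skew_congr_left
  have := h.split_xy.skew_congr_left
  have := h.split_yu.skew_congr_left
  grind

lemma rotate (h : Pentagon a u v w x y) : Pentagon a v w x y u :=
  ⟨h.skew_eq_of_consecutive.1 ▸ h.skew_ne_zero,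
    h.split_vw, h.split_wx, h.split_xy, h.split_yu, h.split_uv⟩

lemma ne (h : Pentagon a u v w x y) : u ≠ w ∧ u ≠ y ∧ v ≠ w ∧ v ≠ y := by
  obtain ⟨-, uw, vw⟩ := pairwise_ne_of_skew_ne_zero h.skew_ne_zero
  have hyuv : skew a y u v ≠ 0 := h.skew_eq_of_consecutive.2.2.2 ▸ h.skew_ne_zero
  obtain ⟨yu, yv, -⟩ := pairwise_ne_of_skew_ne_zero hyuv
  exact ⟨uw, yu.symm, vw, yv.symm⟩

/-- Otherwise `{u, x} | {w, y}` or `{u, v} | {w, x}` would be a split, and would equate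
`skew a u v w` with `±skew a u v x`. -/
lemma xor_isRankOne (hE : RankOneExtends a) (h : Pentagon a u v w x y)
    (heq : skew a u v w ≠ skew a u v x) (hneg : skew a u v w ≠ -skew a u v x) :
    IsRankOne a u x w y ↔ ¬IsRankOne a w y u x := by
  obtain ⟨uw, uy, vw, vy⟩ := h.ne
  have rows := hE u v w y x uw uy vw vy h.split_uv.1
  have columns := hE w y u v x uw.symm vw.symm uy.symm vy.symm h.split_uv.2
  have uv_wx : ¬IsSplit a u v w x := fun hs => heq hs.skew_congr_right
  have ux_wy : ¬IsSplit a u x w y := fun hs => hneg <| by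
    have r := @skew_rotate ι G _ a
    have s := @skew_swap ι G _ a
    have := hs.skew_congr_right
    have := h.skew_eq_of_consecutive
    have := h.skew_eq_of_nonconsecutive
    grind
  unfold IsSplit at uv_wx ux_wy
  tauto

lemma isRankOne_rotate (hE : RankOneExtends a) (h : Pentagon a u v w x y)
    (heq : skew a u v w ≠ skew a u v x) (hneg : skew a u v w ≠ -skew a u v x) :
    IsRankOne a v y x u ↔ ¬IsRankOne a u x w y := by
  have xor := h.xor_isRankOne hE heq hneg
  have xor_rotate := h.rotate.xor_isRankOne hE
    (by grind [h.skew_eq_of_consecutive, h.skew_eq_of_nonconsecutive])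
    (by grind [h.skew_eq_of_consecutive, h.skew_eq_of_nonconsecutive])
  have transfer (hs : IsRankOne a v y x u) : IsRankOne a w y u x :=
    (h.split_vw.1.trans_left hs).swap_right
  have transfer' (hs : IsRankOne a x u v y) : IsRankOne a u x w y :=
    (h.split_vw.2.trans_right hs).swap_left
  tauto

/-- Otherwise `isRankOne_rotate` would alternate around a cycle of odd length. -/
lemma skew_eq_or_eq_neg (hE : RankOneExtends a) (h : Pentagon a u v w x y) :
    skew a u v w = skew a u v x ∨ skew a u v w = -skew a u v x := by
  by_contra! ⟨heq, hneg⟩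
  have alternate {u' v' w' x' y' : ι} (h' : Pentagon a u' v' w' x' y')
      (hc : skew a u' v' w' = skew a u v w) (hn : skew a u' v' x' = skew a u v x) :
      IsRankOne a v' y' x' u' ↔ ¬IsRankOne a u' x' w' y' :=
    h'.isRankOne_rotate hE (hc ▸ hn ▸ heq) (hc ▸ hn ▸ hneg)
  have consecutive := h.skew_eq_of_consecutive
  have nonconsecutive := h.skew_eq_of_nonconsecutive
  have h₀ := alternate h rfl rfl
  have h₁ := alternate h.rotate consecutive.1 nonconsecutive.1
  have h₂ := alternate h.rotate.rotate consecutive.2.1 nonconsecutive.2.1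
  have h₃ := alternate h.rotate.rotate.rotate consecutive.2.2.1 nonconsecutive.2.2.1
  have h₄ := alternate h.rotate.rotate.rotate.rotate consecutive.2.2.2 nonconsecutive.2.2.2
  have flip : IsRankOne a u x y w ↔ IsRankOne a u x w y := ⟨.swap_right, .swap_right⟩
  grind

lemma not_isRankOne (hE : RankOneExtends a) (h : Pentagon a u v w x y)
    (heq : skew a u v w ≠ skew a u v x) :
    ¬IsRankOne a u v y x ∧ ¬IsRankOne a y x u v := by
  have hneg := (h.skew_eq_or_eq_neg hE).resolve_left heq
  have consecutive := h.skew_eq_of_consecutive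
  have nonconsecutive := h.skew_eq_of_nonconsecutive
  have r := @skew_rotate ι G _ a
  have s := @skew_swap ι G _ a
  have xu_vy : IsSplit a x u v y := by
    obtain ⟨vx, vu, wx, wu⟩ := h.rotate.ne
    refine (hE.isSplit_or h.split_vw.symm vx.symm wx.symm vu.symm wu.symm
      (isRankOne_comm_of_skew_eq (by grind))).resolve_left fun hs => heq ?_
    have := hs.symm.skew_congr_right
    grind
  have skew_uvy : skew a u v y ≠ 0 := by
    rw [← r, ← r, consecutive.2.2.2]
    exact h.skew_ne_zero
  rw [← not_or]
  exact fun hs => skew_uvy <|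
    h.split_yu.swap_left.skew_eq_zero_of_isRankOne xu_vy.symm.swap_right hs

end Pentagon

end Splits

section Colorings

variable {ι G : Type*} [AddCommGroup G]

/-- A two-colouring of the triples of indices, given by the triples of the first colour, such that
two triples of different colours with two common indices come from a split; only the triples with
`skew a i j k ≠ 0` matter. -/
structure SplitColoring (a : ι → ι → G) (χ : ι → ι → ι → Prop) : Prop where
  rotate : ∀ i j k, χ j k i ↔ χ i j k
  swap : ∀ i j k, χ j i k ↔ χ i j k
  isSplit : ∀ i j k l, skew a i j k ≠ 0 → skew a i j l ≠ 0 → (χ i j k ↔ ¬χ i j l) →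
    ((χ i k l ↔ χ i j k) ∧ (χ j k l ↔ χ i j l) ∧ IsSplit a i k j l) ∨
      ((χ j k l ↔ χ i j k) ∧ (χ i k l ↔ χ i j l) ∧ IsSplit a j k i l)

/-- A split `{i, j} | {k, l}` such that the triples with two indices in `{i, j}` have one colour
and the triples with two indices in `{k, l}` have the other one. -/
structure MixedSplit (a : ι → ι → G) (χ : ι → ι → ι → Prop) (i j k l : ι) : Prop where
  skew_left : skew a i j k ≠ 0
  skew_right : skew a i k l ≠ 0
  color_left : χ i j l ↔ χ i j k
  color_right : χ j k l ↔ χ i k l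
  color_ne : χ i k l ↔ ¬χ i j k
  split : IsSplit a i j k l

variable {a : ι → ι → G} {χ : ι → ι → ι → Prop} {i j k l m n : ι}

lemma SplitColoring.exists_mixedSplit (hχ : SplitColoring a χ) (hk : skew a i j k ≠ 0)
    (hl : skew a i j l ≠ 0) (hne : χ i j k ↔ ¬χ i j l) : ∃ i j k l, MixedSplit a χ i j k l := by
  have rot := hχ.rotate
  have swap := hχ.swap
  have r := @skew_rotate ι G _ a
  have s := @skew_swap ι G _ a
  rcases hχ.isSplit i j k l hk hl hne with ⟨cik, cjk, hs⟩ | ⟨cjk, cik, hs⟩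
  · have := hs.skew_congr_left
    exact ⟨i, k, j, l, by grind, by grind, by grind, by grind, by grind, hs⟩
  · have := hs.skew_congr_left
    exact ⟨j, k, i, l, by grind, by grind, by grind, by grind, by grind, hs⟩

/-- Replacing one index at a time, the cocycle identity connects any two triples with nonzero
`skew` by triples of the same kind. -/
lemma color_eq_of_forall_adjacent
    (rot : ∀ i j k, χ j k i ↔ χ i j k) (swap : ∀ i j k, χ j i k ↔ χ i j k)
    (adj : ∀ i j k l, skew a i j k ≠ 0 → skew a i j l ≠ 0 → (χ i j k ↔ χ i j l))
    {u v w : ι} (hijk : skew a i j k ≠ 0) (huvw : skew a u v w ≠ 0) : χ i j k ↔ χ u v w := by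
  have r := @skew_rotate ι G _ a
  have s := @skew_swap ι G _ a
  have cocycle := @skew_cocycle ι G _ a
  have move (u : ι) : ∃ p q, skew a u p q ≠ 0 ∧ (χ u p q ↔ χ i j k) := by
    by_contra! hu
    have hij : skew a i j u = 0 := by grind
    have hik : skew a i k u = 0 := by grind
    have hjk : skew a j k u = 0 := by grind
    grind
  obtain ⟨p, q, hupq, hc⟩ := move u
  rw [← hc]
  by_cases hupv : skew a u p v = 0
  · by_cases huqv : skew a u q v = 0
    · by_cases hupw : skew a u p w = 0
      · have hpvq : skew a p v q ≠ 0 := by grind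
        have hpvw : skew a p v w ≠ 0 := by grind
        have := adj p q u v (by grind) (by grind)
        have := adj p v q w hpvq hpvw
        have := adj v w p u (by grind) (by grind)
        grind
      · have := adj u p q w hupq hupw
        have := adj u w p v (by grind) (by grind)
        grind
    · have := adj u q p v (by grind) huqv
      have := adj u v q w (by grind) huvw
      grind
  · have := adj u p q v hupq hupv
    have := adj u v p w (by grind) huvw
    grind

lemma SplitColoring.color_eq_of_forall_not_mixedSplit (hχ : SplitColoring a χ)
    (hmixed : ∀ i j k l, ¬MixedSplit a χ i j k l) {u v w : ι}
    (hijk : skew a i j k ≠ 0) (huvw : skew a u v w ≠ 0) : χ i j k ↔ χ u v w := by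
  refine color_eq_of_forall_adjacent hχ.rotate hχ.swap (fun i j k l hk hl => ?_) hijk huvw
  by_contra hne
  obtain ⟨i, j, k, l, h⟩ := hχ.exists_mixedSplit hk hl (by tauto)
  exact hmixed i j k l h

namespace MixedSplit

lemma swap_left (hχ : SplitColoring a χ) (h : MixedSplit a χ i j k l) :
    MixedSplit a χ j i k l where
  skew_left := by rw [skew_swap]; exact neg_ne_zero.2 h.skew_left
  skew_right := h.split.skew_congr_left ▸ h.skew_right
  color_left := by rw [hχ.swap i j l, hχ.swap i j k, h.color_left]
  color_right := h.color_right.symm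
  color_ne := by rw [hχ.swap i j k, h.color_right, h.color_ne]
  split := h.split.swap_left

lemma ne (h : MixedSplit a χ i j k l) : i ≠ j ∧ i ≠ k ∧ i ≠ l ∧ j ≠ k ∧ j ≠ l ∧ k ≠ l := by
  obtain ⟨ij, ik, jk⟩ := pairwise_ne_of_skew_ne_zero h.skew_left
  obtain ⟨-, il, kl⟩ := pairwise_ne_of_skew_ne_zero h.skew_right
  have jl := (pairwise_ne_of_skew_ne_zero (h.split.skew_congr_left ▸ h.skew_right)).2.1
  exact ⟨ij, ik, il, jk, jl, kl⟩

lemma mixedSplit_or_pentagon_of_color (hχ : SplitColoring a χ) (h : MixedSplit a χ i j k l)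
    (hm : ¬IsSplit a i j k m) (hikm : skew a i k m ≠ 0) (color_ikm : χ i k m ↔ χ i j k) :
    MixedSplit a χ i m k l ∨ Pentagon a i j l m k := by
  have rot := hχ.rotate
  have swap := hχ.swap
  have r := @skew_rotate ι G _ a
  have s := @skew_swap ι G _ a
  have hm' : ¬IsSplit a i j l m := fun hs => hm (h.split.swap_right.trans_right hs)
  obtain ⟨hijk, hikl, color_left, color_right, color_ne, ij_kl⟩ := h
  rcases hχ.isSplit i k m l hikm hikl (by tauto) with
    ⟨color_iml, color_kml, im_kl⟩ | ⟨color_kml, color_iml, km_il⟩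
  · exact .inl ⟨by grind, hikl, by grind, by grind, by grind, im_kl⟩
  right
  have hilj : skew a i l j ≠ 0 := by grind [ij_kl.skew_congr_right]
  have hilm : skew a i l m ≠ 0 := by grind [km_il.symm.skew_congr_right]
  have hklm : skew a k l m ≠ 0 := by grind [km_il.skew_congr_right]
  have hklj : skew a k l j ≠ 0 := by grind [ij_kl.skew_congr_left]
  obtain ⟨-, color_kmj, lm_kj⟩ :=
    (hχ.isSplit k l m j hklm hklj (by grind)).resolve_left fun h' =>
      hm (km_il.swap_right.trans_right h'.2.2).symm
  have hjkm : skew a j k m ≠ 0 := by grind [lm_kj.symm.skew_congr_right]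
  obtain ⟨-, -, ki_jm⟩ := (hχ.isSplit j k i m (by grind) hjkm (by grind)).resolve_left
    fun h' => hm h'.2.2.swap_left
  obtain ⟨-, -, lj_im⟩ := (hχ.isSplit i l j m hilj hilm (by grind)).resolve_left
    fun h' => hm' h'.2.2
  exact ⟨by grind, ij_kl.swap_right, lj_im.swap_left.swap_right, lm_kj,
    km_il.swap_left, ki_jm⟩

/-- If `i, k, m` has the wrong colour, then `j, k, m` has the right one. -/
lemma mixedSplit_or_pentagon (hχ : SplitColoring a χ) (h : MixedSplit a χ i j k l)
    (hm : ¬IsSplit a i j k m) (hikm : skew a i k m ≠ 0) :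
    MixedSplit a χ i m k l ∨ MixedSplit a χ j m k l ∨
      Pentagon a i j l m k ∨ Pentagon a j i l m k := by
  have rot := hχ.rotate
  have swap := hχ.swap
  have r := @skew_rotate ι G _ a
  have s := @skew_swap ι G _ a
  by_cases color_ikm : χ i k m ↔ χ i j k
  · have := h.mixedSplit_or_pentagon_of_color hχ hm hikm color_ikm
    tauto
  have hikj : skew a i k j ≠ 0 := by grind [h.skew_left]
  obtain ⟨color_jkm, -, kj_im⟩ := (hχ.isSplit i k j m hikj hikm (by grind)).resolve_left
    fun h' => hm h'.2.2
  rw [swap, ← rot, swap] at color_jkm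
  have hjkm : skew a j k m ≠ 0 := by grind [kj_im.skew_congr_right]
  have := (h.swap_left hχ).mixedSplit_or_pentagon_of_color hχ (mt IsSplit.swap_left hm) hjkm
    (by grind)
  tauto

lemma replace (hE : RankOneExtends a) (hχ : SplitColoring a χ) (h : MixedSplit a χ i j k l)
    (hm : ¬IsSplit a i j k m) (hn : IsSplit a i j k n) (hin : i ≠ n) (hjn : j ≠ n)
    (himn : ¬IsSplit a i m k n) : MixedSplit a χ i m k l ∨ MixedSplit a χ j m k l := by
  obtain ⟨-, hik, -, hjk, -⟩ := h.ne
  have h' := h.swap_left hχ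
  have not_comm : ¬(IsRankOne a i j k m ↔ IsRankOne a k m i j) := fun hcomm =>
    (hE.isSplit_or hn hik hin hjk hjn hcomm).elim himn hm
  have hne : skew a i j k ≠ skew a i j m := fun heq =>
    not_comm (isRankOne_comm_of_skew_eq heq)
  have not_pentagon : ¬Pentagon a i j l m k := fun hp => by
    obtain ⟨rows, columns⟩ := hp.not_isRankOne hE (h.split.skew_congr_right ▸ hne)
    exact not_comm (iff_of_false rows columns)
  have not_pentagon' : ¬Pentagon a j i l m k := fun hp => by
    have hne' : skew a j i l ≠ skew a j i m := by
      rw [← h'.split.skew_congr_right, skew_swap, skew_swap i j m]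
      exact neg_injective.ne hne
    obtain ⟨rows, columns⟩ := hp.not_isRankOne hE hne'
    exact not_comm (iff_of_false (mt .swap_left rows) (mt .swap_right columns))
  by_cases hikm : skew a i k m = 0
  · have hjkm : skew a j k m ≠ 0 := fun hjkm =>
      hne ((skew_eq_iff ..).2 (hikm.trans hjkm.symm))
    have := h'.mixedSplit_or_pentagon hχ (mt .swap_left hm) hjkm
    tauto
  · have := h.mixedSplit_or_pentagon hχ hm hikm
    tauto

/-- By `replace`, an index that no pair in the connected component of `{i, j}` splits from `k`
lies on the side of `i, j`. -/
lemma exists_cut (hE : RankOneExtends a) (hχ : SplitColoring a χ) (h : MixedSplit a χ i j k l) :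
    ∃ X : Set ι, i ∈ X ∧ j ∈ X ∧ k ∉ X ∧ l ∉ X ∧ ∀ x ∈ X, ∀ y ∉ X, IsSplit a i x k y := by
  let R (p q : ι) : Prop := MixedSplit a χ p q k l
  let X : Set ι :=
    {x | ∃ p q, Relation.ReflTransGen R i p ∧ R p q ∧ (x = p ∨ x = q ∨ ¬IsSplit a p q k x)}
  have not_mem {y p q : ι} (hy : y ∉ X) (hp : Relation.ReflTransGen R i p) (hpq : R p q) :
      p ≠ y ∧ q ≠ y ∧ IsSplit a p q k y := by
    refine ⟨?_, ?_, ?_⟩ <;> by_contra hpqy <;> exact hy ⟨p, q, hp, hpq, by tauto⟩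
  have reachable {y p : ι} (hy : y ∉ X) (hp : Relation.ReflTransGen R i p) :
      IsSplit a i p k y := by
    induction hp with
    | refl => exact .self_left ..
    | tail hp hpq ih => exact ih.swap_left.trans_left (not_mem hy hp hpq).2.2
  refine ⟨X, ⟨i, j, .refl, h, .inl rfl⟩, ⟨i, j, .refl, h, .inr (.inl rfl)⟩, ?_, ?_, ?_⟩
  · rintro ⟨p, q, -, hpq, rfl | rfl | hk⟩
    exacts [hpq.ne.2.1 rfl, hpq.ne.2.2.2.1 rfl, hk (.self_right ..)]
  · rintro ⟨p, q, -, hpq, rfl | rfl | hl⟩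
    exacts [hpq.ne.2.2.1 rfl, hpq.ne.2.2.2.2.1 rfl, hl hpq.split]
  · rintro x ⟨p, q, hp, hpq, rfl | rfl | hx⟩ y hy
    · exact reachable hy hp
    · exact reachable hy (hp.tail hpq)
    · obtain ⟨hpy, hqy, hs⟩ := not_mem hy hp hpq
      suffices IsSplit a p x k y from (reachable hy hp).swap_left.trans_left this
      by_contra hpx
      rcases hpq.replace hE hχ hx hs hpy hqy hpx with hpx' | hqx
      · exact hpx (not_mem hy hp hpx').2.2
      · exact hpx (hs.swap_left.trans_left (not_mem hy (hp.tail hpq) hqx).2.2)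

end MixedSplit

end Colorings

section Rank

variable {m n F : Type*} [Fintype n] [Field F]

lemma le_rank_of_det_submatrix_ne_zero {r : ℕ} {M : Matrix m n F} (f : Fin r → m) (g : Fin r → n)
    (h : (M.submatrix f g).det ≠ 0) : r ≤ M.rank := by
  simpa only [Matrix.rank_of_det_ne_zero h, Fintype.card_fin] using M.rank_submatrix_le f g

lemma rank_le_one_iff_forall_mul_eq_mul {M : Matrix m n F} :
    M.rank ≤ 1 ↔ ∀ i j k l, M i k * M j l = M i l * M j k := by
  constructor
  · intro h i j k l
    by_contra hne
    have := le_rank_of_det_submatrix_ne_zero (M := M) ![i, j] ![k, l] <| by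
      rw [Matrix.det_fin_two]
      exact sub_ne_zero.2 hne
    omega
  · intro h
    by_cases hM : ∃ i k, M i k ≠ 0
    · obtain ⟨i₀, k₀, h₀⟩ := hM
      have : M = Matrix.vecMulVec (fun i => M i k₀ / M i₀ k₀) (M i₀) := by
        ext i k
        rw [Matrix.vecMulVec_apply, div_mul_eq_mul_div, eq_div_iff h₀, h]
      rw [this]
      exact Matrix.rank_vecMulVec_le _ _
    · push Not at hM
      have : M = 0 := Matrix.ext hM
      simp [this]

end Rank

section CyclicProducts

open scoped Matrix

variable {ι R : Type*} [CommRing R] {A B : Matrix ι ι R} {i j k l : ι}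

/-- The cyclic product of three entries. -/
def cyc (A : Matrix ι ι R) (i j k : ι) : R := A i j * A j k * A k i

lemma cyc_rotate (A : Matrix ι ι R) (i j k : ι) : cyc A j k i = cyc A i j k := by
  unfold cyc; ring

lemma cyc_transpose (A : Matrix ι ι R) (i j k : ι) : cyc Aᵀ i j k = cyc A i k j := by
  unfold cyc; simp only [Matrix.transpose_apply]; ring

lemma cyc_submatrix {κ : Type*} (v : κ → ι) (p q r : κ) :
    cyc (A.submatrix v v) p q r = cyc A (v p) (v q) (v r) := rfl

lemma cyc_mul_cyc (A : Matrix ι ι R) (i j k : ι) :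
    cyc A i j k * cyc A i k j = (A i j * A j i) * (A i k * A k i) * (A j k * A k j) := by
  unfold cyc; ring

lemma mul_cyc_eq (A : Matrix ι ι R) (i j k l : ι) :
    (A i j * A j i) * (A i k * A k i) * (A i l * A l i) * cyc A j k l =
      cyc A i j k * cyc A i k l * cyc A i l j := by
  unfold cyc; ring

/-- The sum of the six cyclic products of length four on `i, j, k, l`. -/
def cycSum (A : Matrix ι ι R) (i j k l : ι) : R :=
  A i j * A j k * A k l * A l i + A i j * A j l * A l k * A k i + A i k * A k j * A j l * A l i +
  A i k * A k l * A l j * A j i + A i l * A l j * A j k * A k i + A i l * A l k * A k j * A j i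

lemma cycSum_submatrix {κ : Type*} (v : κ → ι) (p q r s : κ) :
    cycSum (A.submatrix v v) p q r s = cycSum A (v p) (v q) (v r) (v s) := rfl

lemma mul_cycSum_eq (A : Matrix ι ι R) (i j k l : ι) :
    (A i j * A j i) * (A i k * A k i) * (A i l * A l i) * cycSum A i j k l =
      (A i j * A j i) * (A i l * A l i) * (cyc A i j k * cyc A i k l + cyc A i k j * cyc A i l k) +
      (A i j * A j i) * (A i k * A k i) * (cyc A i j l * cyc A i l k + cyc A i l j * cyc A i k l) +
      (A i k * A k i) * (A i l * A l i) *
        (cyc A i k j * cyc A i j l + cyc A i j k * cyc A i l j) := by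
  unfold cyc cycSum; ring

lemma det_fin_three_eq_cyc (M : Matrix (Fin 3) (Fin 3) R) :
    M.det = M 0 0 * M 1 1 * M 2 2 - M 0 0 * (M 1 2 * M 2 1) - M 1 1 * (M 0 2 * M 2 0)
      - M 2 2 * (M 0 1 * M 1 0) + (cyc M 0 1 2 + cyc M 0 2 1) := by
  rw [Matrix.det_fin_three]
  unfold cyc
  ring

lemma det_fin_four_eq_cyc (M : Matrix (Fin 4) (Fin 4) R) :
    M.det = M 0 0 * M 1 1 * M 2 2 * M 3 3 - M 2 2 * M 3 3 * (M 0 1 * M 1 0)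
      - M 1 1 * M 3 3 * (M 0 2 * M 2 0) - M 1 1 * M 2 2 * (M 0 3 * M 3 0)
      - M 0 0 * M 3 3 * (M 1 2 * M 2 1) - M 0 0 * M 2 2 * (M 1 3 * M 3 1)
      - M 0 0 * M 1 1 * (M 2 3 * M 3 2) + (M 0 1 * M 1 0) * (M 2 3 * M 3 2)
      + (M 0 2 * M 2 0) * (M 1 3 * M 3 1) + (M 0 3 * M 3 0) * (M 1 2 * M 2 1)
      + M 3 3 * (cyc M 0 1 2 + cyc M 0 2 1) + M 2 2 * (cyc M 0 1 3 + cyc M 0 3 1)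
      + M 1 1 * (cyc M 0 2 3 + cyc M 0 3 2) + M 0 0 * (cyc M 1 2 3 + cyc M 1 3 2)
      - cycSum M 0 1 2 3 := by
  have rows : (Fin.succ : Fin 3 → Fin 4) = ![1, 2, 3] := by decide
  have columns₀ : (0 : Fin 4).succAbove = ![1, 2, 3] := by decide
  have columns₁ : (1 : Fin 4).succAbove = ![0, 2, 3] := by decide
  have columns₂ : (2 : Fin 4).succAbove = ![0, 1, 3] := by decide
  have columns₃ : (3 : Fin 4).succAbove = ![0, 1, 2] := by decide
  rw [Matrix.det_succ_row_zero, Fin.sum_univ_four, rows, columns₀, columns₁, columns₂, columns₃]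
  simp only [Matrix.det_fin_three, Matrix.submatrix_apply, Matrix.cons_val, Fin.coe_ofNat_eq_mod,
    cyc, cycSum]
  ring

/-- Equality of the diagonal entries and of the sums of cyclic products of length at most four. -/
structure CycEq (A B : Matrix ι ι R) : Prop where
  diag : ∀ i, A i i = B i i
  pair : ∀ i j, A i j * A j i = B i j * B j i
  triple : ∀ i j k, cyc A i j k + cyc A i k j = cyc B i j k + cyc B i k j
  quad : ∀ i j k l, cycSum A i j k l = cycSum B i j k l

/-- The two cyclic products of `B` on `i, j, k` agree with those of `A`. Given equal sums and
products of the two, the alternative is `SameCycles A Bᵀ i j k`: they are interchanged. -/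
def SameCycles (A B : Matrix ι ι R) (i j k : ι) : Prop :=
  cyc B i j k = cyc A i j k ∧ cyc B i k j = cyc A i k j

lemma sameCycles_transpose_iff :
    SameCycles A Bᵀ i j k ↔ cyc B i k j = cyc A i j k ∧ cyc B i j k = cyc A i k j := by
  unfold SameCycles
  rw [cyc_transpose, cyc_transpose]

lemma sameCycles_rotate (A B : Matrix ι ι R) (i j k : ι) :
    SameCycles A B j k i ↔ SameCycles A B i j k := by
  unfold SameCycles
  rw [cyc_rotate B i j k, cyc_rotate A i j k, ← cyc_rotate B j i k, ← cyc_rotate A j i k]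

lemma sameCycles_swap (A B : Matrix ι ι R) (i j k : ι) :
    SameCycles A B j i k ↔ SameCycles A B i j k := by
  unfold SameCycles
  rw [cyc_rotate B i j k, cyc_rotate A i j k, ← cyc_rotate B j i k, ← cyc_rotate A j i k, and_comm]

lemma CycEq.transpose (h : CycEq A B) : CycEq A Bᵀ where
  diag := h.diag
  pair i j := by rw [h.pair]; exact mul_comm _ _
  triple i j k := by rw [h.triple, cyc_transpose, cyc_transpose, add_comm]
  quad i j k l := by
    rw [h.quad]
    unfold cycSum
    simp only [Matrix.transpose_apply]
    ring

variable [NoZeroDivisors R]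

lemma eq_or_swap_of_add_mul {x y x' y' : R} (add : x + y = x' + y') (mul : x * y = x' * y') :
    (x' = x ∧ y' = y) ∨ (x' = y ∧ y' = x) := by
  have : (x' - x) * (x' - y) = 0 := by linear_combination mul - x' * add
  rcases mul_eq_zero.1 this with h | h <;> grind

namespace CycEq

lemma sameCycles_or_transpose (h : CycEq A B) (i j k : ι) :
    SameCycles A B i j k ∨ SameCycles A Bᵀ i j k := by
  rw [sameCycles_transpose_iff, and_comm (a := cyc B i k j = _)]
  refine eq_or_swap_of_add_mul (h.triple i j k) ?_
  rw [cyc_mul_cyc, cyc_mul_cyc, h.pair, h.pair, h.pair]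

lemma cyc_mul_cyc_eq (h : CycEq A B) (hl : cyc A i j l ≠ cyc A i l j)
    (same_ijk : SameCycles A B i j k) (opp_ijl : SameCycles A Bᵀ i j l)
    (same_ikl : SameCycles A B i k l) :
    cyc A i j k * cyc A i k l = cyc A i k j * cyc A i l k := by
  rw [sameCycles_transpose_iff] at opp_ijl
  have jkl_B := mul_cyc_eq B i j k l
  have jlk_B := mul_cyc_eq B i j l k
  simp only [← h.pair, same_ijk.1, same_ijk.2, same_ikl.1, same_ikl.2, opp_ijl.1,
    opp_ijl.2] at jkl_B jlk_B
  refine mul_right_cancel₀ (sub_ne_zero.2 hl) ?_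
  linear_combination mul_cyc_eq A i j k l + mul_cyc_eq A i j l k - jkl_B - jlk_B
    - (A i j * A j i) * (A i k * A k i) * (A i l * A l i) * h.triple j k l

/-- `quad` and `cyc_mul_cyc_eq` give the sum and the product of the two left-hand sides; `hk`
excludes the other matching. -/
lemma mul_cyc_eq_mul_cyc (h : CycEq A B) (hik : A i k * A k i ≠ 0) (hil : A i l * A l i ≠ 0)
    (hk : cyc A i j k ≠ cyc A i k j) (hl : cyc A i j l ≠ cyc A i l j)
    (same_ijk : SameCycles A B i j k) (opp_ijl : SameCycles A Bᵀ i j l)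
    (same_ikl : SameCycles A B i k l) :
    (A i l * A l i) * cyc A i j k = (A i j * A j i) * cyc A i l k ∧
      (A i j * A j i) * cyc A i k l = (A i l * A l i) * cyc A i k j := by
  have products := h.cyc_mul_cyc_eq hl same_ijk opp_ijl same_ikl
  have sums : (A i j * A j i) * cyc A i k l + (A i l * A l i) * cyc A i j k =
      (A i j * A j i) * cyc A i l k + (A i l * A l i) * cyc A i k j := by
    rw [sameCycles_transpose_iff] at opp_ijl
    have quad_B := mul_cycSum_eq B i j k l
    simp only [← h.pair, ← h.quad, same_ijk.1, same_ijk.2, same_ikl.1, same_ikl.2, opp_ijl.1,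
      opp_ijl.2] at quad_B
    refine mul_right_cancel₀ (mul_ne_zero hik (sub_ne_zero.2 hl)) ?_
    linear_combination mul_cycSum_eq A i j k l - quad_B
  obtain ⟨ilk, ikj⟩ := (eq_or_swap_of_add_mul sums <| by
    linear_combination (A i j * A j i) * (A i l * A l i) * products).resolve_left
      fun h' => hk (mul_left_cancel₀ hil h'.2.symm)
  exact ⟨ilk.symm, ikj.symm⟩

lemma sameCycles_transpose_of_mul_cyc_eq (h : CycEq A B) (hij : A i j * A j i ≠ 0)
    (hik : A i k * A k i ≠ 0) (hil : A i l * A l i ≠ 0)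
    (same_ijk : SameCycles A B i j k) (opp_ijl : SameCycles A Bᵀ i j l)
    (same_ikl : SameCycles A B i k l)
    (products : cyc A i j k * cyc A i k l = cyc A i k j * cyc A i l k) :
    SameCycles A Bᵀ j k l := by
  rw [sameCycles_transpose_iff] at opp_ijl ⊢
  have jkl_B := mul_cyc_eq B i j k l
  have jlk_B := mul_cyc_eq B i j l k
  simp only [← h.pair, same_ijk.1, same_ijk.2, same_ikl.1, same_ikl.2, opp_ijl.1,
    opp_ijl.2] at jkl_B jlk_B
  have hP := mul_ne_zero (mul_ne_zero hij hik) hil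
  refine ⟨mul_left_cancel₀ hP ?_, mul_left_cancel₀ hP ?_⟩
  · linear_combination jlk_B - mul_cyc_eq A i j k l - cyc A i l j * products
  · linear_combination jkl_B - mul_cyc_eq A i j l k + cyc A i j l * products

end CycEq

end CyclicProducts

section Entries

variable {ι F : Type*} [Field F] {A : Matrix ι ι F} {i j k l : ι}

open Classical in
/-- The entries of a matrix as elements of the additive group of units; zero entries are sent to
the junk value `0`. -/
noncomputable def logEntry (A : Matrix ι ι F) (i j : ι) : Additive Fˣ :=
  if h : A i j = 0 then 0 else .ofMul (Units.mk0 (A i j) h)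

lemma isRankOne_logEntry (hik : A i k ≠ 0) (hil : A i l ≠ 0) (hjk : A j k ≠ 0) (hjl : A j l ≠ 0) :
    IsRankOne (logEntry A) i j k l ↔ A i k * A j l = A i l * A j k := by
  simp only [IsRankOne, logEntry, hik, hil, hjk, hjl, dif_neg, not_false_eq_true, ← ofMul_mul,
    EmbeddingLike.apply_eq_iff_eq, Units.ext_iff, Units.val_mul, Units.val_mk0]

lemma skew_logEntry (hA : IsDense A) (i j k : ι) :
    skew (logEntry A) i j k = 0 ↔ cyc A i j k = cyc A i k j := by
  by_cases h : i ≠ j ∧ i ≠ k ∧ j ≠ k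
  · obtain ⟨ij, ik, jk⟩ := h
    simp only [skew, sub_eq_zero, logEntry, hA _ _ ij, hA _ _ ik, hA _ _ jk, hA _ _ ij.symm,
      hA _ _ ik.symm, hA _ _ jk.symm, dif_neg, not_false_eq_true, ← ofMul_mul,
      EmbeddingLike.apply_eq_iff_eq, Units.ext_iff, Units.val_mul, Units.val_mk0]
    unfold cyc
    constructor <;> intro h <;> linear_combination h
  · refine iff_of_true (not_not.1 (mt pairwise_ne_of_skew_ne_zero h)) ?_
    unfold cyc
    grind

/-- For disjoint `S` and `T`, the diagonal of `A` does not meet the block. -/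
lemma rank_sub_le_one_iff (hA : IsDense A) {S T : Finset ι} (hST : Disjoint S T) :
    (sub A S T).rank ≤ 1 ↔
      ∀ i ∈ S, ∀ j ∈ S, ∀ k ∈ T, ∀ l ∈ T, IsRankOne (logEntry A) i j k l := by
  have ne_zero {i k : ι} (hi : i ∈ S) (hk : k ∈ T) : A i k ≠ 0 :=
    hA i k fun h => Finset.disjoint_left.1 hST hi (h ▸ hk)
  rw [rank_le_one_iff_forall_mul_eq_mul]
  refine ⟨fun h i hi j hj k hk l hl => ?_, fun h ⟨i, hi⟩ ⟨j, hj⟩ ⟨k, hk⟩ ⟨l, hl⟩ => ?_⟩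
  · exact (isRankOne_logEntry (ne_zero hi hk) (ne_zero hi hl) (ne_zero hj hk) (ne_zero hj hl)).2
      (h ⟨i, hi⟩ ⟨j, hj⟩ ⟨k, hk⟩ ⟨l, hl⟩)
  · exact (isRankOne_logEntry (ne_zero hi hk) (ne_zero hi hl) (ne_zero hj hk) (ne_zero hj hl)).1
      (h i hi j hj k hk l hl)

variable [Fintype ι] [DecidableEq ι]

lemma RankOneExtension.rankOneExtends (hA : IsDense A) (hR : RankOneExtension A) :
    RankOneExtends (logEntry A) := by
  intro i j k l m ik il jk jl h
  by_cases ij : i = j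
  · exact .inr (ij ▸ isRankOne_self_left ..)
  by_cases kl : k = l
  · exact .inl (kl ▸ isRankOne_self_right ..)
  have hrank : (sub A {i, j} {k, l}).rank = 1 := by
    refine le_antisymm ((rank_sub_le_one_iff hA (by simp [*, Ne.symm])).2 ?_) ?_
    · simp only [Finset.mem_insert, Finset.mem_singleton]
      rintro _ (rfl | rfl) _ (rfl | rfl) _ (rfl | rfl) _ (rfl | rfl) <;>
        simp [h, h.swap_left, h.swap_right, h.swap_left.swap_right, isRankOne_self_left,
          isRankOne_self_right]
    · refine le_rank_of_det_submatrix_ne_zero ![⟨i, by simp⟩] ![⟨k, by simp⟩] ?_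
      rw [Matrix.det_fin_one]
      exact hA i k ik
  obtain ⟨X, hi, hj, hk, hl, hX⟩ := hR i j k l (by simp [*]) hrank
  have block := (rank_sub_le_one_iff hA disjoint_compl_right).1 hX.le
  by_cases hm : m ∈ X
  · exact .inl (block i hi m hm k hk l hl)
  · exact .inr (block i hi j hj k hk m (Finset.mem_compl.2 hm))

lemma isCut_of_forall_isSplit (hA : IsDense A) {X : Finset ι} (hi : i ∈ X) (hj : j ∈ X)
    (hk : k ∉ X) (hl : l ∉ X) (ij : i ≠ j) (kl : k ≠ l)
    (h : ∀ x ∈ X, ∀ y ∉ X, IsSplit (logEntry A) i x k y) : IsCut A X := by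
  have split {x x' y y' : ι} (hx : x ∈ X) (hx' : x' ∈ X) (hy : y ∈ Xᶜ) (hy' : y' ∈ Xᶜ) :
      IsSplit (logEntry A) x x' y y' := by
    rw [Finset.mem_compl] at hy hy'
    exact ((h x hx y hy).trans_right (h x hx y' hy')).trans_left
      ((h x' hx' y hy).trans_right (h x' hx' y' hy'))
  have card_compl : 2 ≤ Xᶜ.card := Finset.one_lt_card.2
    ⟨k, Finset.mem_compl.2 hk, l, Finset.mem_compl.2 hl, kl⟩
  rw [Finset.card_compl] at card_compl
  refine ⟨Finset.one_lt_card.2 ⟨i, hi, j, hj, ij⟩, by omega, ?_, ?_⟩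
  · exact (rank_sub_le_one_iff hA disjoint_compl_right).2
      fun _ hx _ hx' _ hy _ hy' => (split hx hx' hy hy').1
  · exact (rank_sub_le_one_iff hA disjoint_compl_left).2
      fun _ hy _ hy' _ hx _ hx' => (split hx hx' hy hy').2

lemma MixedSplit.exists_isCut (hA : IsDense A) (hR : RankOneExtension A) {χ : ι → ι → ι → Prop}
    (hχ : SplitColoring (logEntry A) χ) (h : MixedSplit (logEntry A) χ i j k l) :
    ∃ X, IsCut A X := by
  obtain ⟨X, hi, hj, hk, hl, hX⟩ := h.exists_cut (hR.rankOneExtends hA) hχ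
  obtain ⟨ij, -, -, -, -, kl⟩ := h.ne
  refine ⟨X.toFinite.toFinset, isCut_of_forall_isSplit (i := i) (j := j) (k := k) (l := l) hA
    ?_ ?_ ?_ ?_ ij kl ?_⟩ <;> simpa only [Set.Finite.mem_toFinset]

end Entries

section SmallMinors

variable {ι F : Type*} [DecidableEq ι] [Field F] {A B : Matrix ι ι F}

lemma PMEUpTo.det_submatrix_eq {d m : ℕ} (h : PMEUpTo d A B) (hm : m ≤ d) (v : Fin m → ι) :
    (A.submatrix v v).det = (B.submatrix v v).det := by
  by_cases hv : Function.Injective v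
  · let e : Fin m ≃ Finset.univ.map ⟨v, hv⟩ :=
      (Equiv.ofInjective v hv).trans (Equiv.subtypeEquivRight (by simp))
    have := h (Finset.univ.map ⟨v, hv⟩) (by simpa using hm)
    rw [← Matrix.det_submatrix_equiv_self e,
      ← Matrix.det_submatrix_equiv_self e (sub B _ _)] at this
    exact this
  · obtain ⟨p, q, hpq, hne⟩ := Function.not_injective_iff.1 hv
    rw [Matrix.det_zero_of_row_eq hne (by ext; simp [hpq]),
      Matrix.det_zero_of_row_eq hne (by ext; simp [hpq])]

lemma PMEUpTo.cycEq (h : PMEUpTo 4 A B) : CycEq A B := by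
  have diag (i : ι) : A i i = B i i := by
    have := h.det_submatrix_eq (by norm_num) ![i]
    rwa [Matrix.det_fin_one, Matrix.det_fin_one] at this
  have pair (i j : ι) : A i j * A j i = B i j * B j i := by
    have := h.det_submatrix_eq (by norm_num) ![i, j]
    rw [Matrix.det_fin_two, Matrix.det_fin_two] at this
    simp only [Matrix.submatrix_apply, Matrix.cons_val, diag] at this
    linear_combination -this
  have triple (i j k : ι) : cyc A i j k + cyc A i k j = cyc B i j k + cyc B i k j := by
    have := h.det_submatrix_eq (by norm_num) ![i, j, k]
    rw [det_fin_three_eq_cyc, det_fin_three_eq_cyc] at this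
    simp only [cyc_submatrix, Matrix.submatrix_apply, Matrix.cons_val, diag, pair] at this
    linear_combination this
  refine ⟨diag, pair, triple, fun i j k l => ?_⟩
  have := h.det_submatrix_eq le_rfl ![i, j, k, l]
  rw [det_fin_four_eq_cyc, det_fin_four_eq_cyc] at this
  simp only [cyc_submatrix, cycSum_submatrix, Matrix.submatrix_apply, Matrix.cons_val, diag, pair,
    triple] at this
  linear_combination -this

end SmallMinors

section TripleColoring

open scoped Matrix

variable {ι F : Type*} [Field F] {A B : Matrix ι ι F} {i j k l : ι}

namespace CycEq

lemma sameCycles_of_skew_eq_zero (h : CycEq A B) (hA : IsDense A)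
    (hs : skew (logEntry A) i j k = 0) : SameCycles A B i j k := by
  have hcyc := (skew_logEntry hA i j k).1 hs
  refine (h.sameCycles_or_transpose i j k).elim id fun h' => ?_
  obtain ⟨hikj, hijk⟩ := sameCycles_transpose_iff.1 h'
  exact ⟨hijk.trans hcyc.symm, hikj.trans hcyc⟩

lemma sameCycles_transpose_iff_not (h : CycEq A B) (hA : IsDense A)
    (hs : skew (logEntry A) i j k ≠ 0) : SameCycles A Bᵀ i j k ↔ ¬SameCycles A B i j k := by
  refine ⟨fun hopp hsame => hs ?_, (h.sameCycles_or_transpose i j k).resolve_left⟩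
  rw [skew_logEntry hA, ← hsame.1, (sameCycles_transpose_iff.1 hopp).2]

lemma isSplit_of_sameCycles (h : CycEq A B) (hA : IsDense A)
    (hk : skew (logEntry A) i j k ≠ 0) (hl : skew (logEntry A) i j l ≠ 0)
    (same_ijk : SameCycles A B i j k) (opp_ijl : SameCycles A Bᵀ i j l)
    (same_ikl : SameCycles A B i k l) :
    SameCycles A Bᵀ j k l ∧ IsSplit (logEntry A) i k j l := by
  obtain ⟨ij, ik, jk⟩ := pairwise_ne_of_skew_ne_zero hk
  obtain ⟨-, il, jl⟩ := pairwise_ne_of_skew_ne_zero hl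
  have kl : k ≠ l := by
    rintro rfl
    exact (h.sameCycles_transpose_iff_not hA hl).1 opp_ijl same_ijk
  rw [ne_eq, skew_logEntry hA] at hk hl
  have pair_ne_zero {u v : ι} (uv : u ≠ v) := mul_ne_zero (hA u v uv) (hA v u uv.symm)
  have products := h.cyc_mul_cyc_eq hl same_ijk opp_ijl same_ikl
  obtain ⟨rows, columns⟩ := h.mul_cyc_eq_mul_cyc (pair_ne_zero ik) (pair_ne_zero il) hk hl
    same_ijk opp_ijl same_ikl
  unfold cyc at rows columns
  refine ⟨h.sameCycles_transpose_of_mul_cyc_eq (pair_ne_zero ij) (pair_ne_zero ik) (pair_ne_zero il)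
    same_ijk opp_ijl same_ikl products, ?_, ?_⟩
  · rw [isRankOne_logEntry (hA i j ij) (hA i l il) (hA k j jk.symm) (hA k l kl)]
    refine mul_left_cancel₀
      (mul_ne_zero (mul_ne_zero (hA j i ij.symm) (hA l i il.symm)) (hA i k ik)) ?_
    linear_combination columns
  · rw [isRankOne_logEntry (hA j i ij.symm) (hA j k jk) (hA l i il.symm) (hA l k kl.symm)]
    refine mul_left_cancel₀
      (mul_ne_zero (mul_ne_zero (hA i j ij) (hA i l il)) (hA k i ik.symm)) ?_
    linear_combination -rows

/-- Whichever colour `i, k, l` has, it agrees with one of the two given triples. -/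
lemma isSplit_or_isSplit (h : CycEq A B) (hA : IsDense A)
    (hk : skew (logEntry A) i j k ≠ 0) (hl : skew (logEntry A) i j l ≠ 0)
    (same_ijk : SameCycles A B i j k) (opp_ijl : SameCycles A Bᵀ i j l) :
    (SameCycles A B i k l ∧ SameCycles A Bᵀ j k l ∧ IsSplit (logEntry A) i k j l) ∨
      (SameCycles A B j k l ∧ SameCycles A Bᵀ i k l ∧ IsSplit (logEntry A) j k i l) := by
  rcases h.sameCycles_or_transpose i k l with same_ikl | opp_ikl
  · exact .inl ⟨same_ikl, h.isSplit_of_sameCycles hA hk hl same_ijk opp_ijl same_ikl⟩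
  · obtain ⟨same_jlk, hs⟩ := h.transpose.isSplit_of_sameCycles hA hl hk opp_ijl
      (by rwa [Matrix.transpose_transpose]) (by rwa [sameCycles_rotate, sameCycles_swap])
    rw [Matrix.transpose_transpose, sameCycles_rotate, sameCycles_swap] at same_jlk
    exact .inr ⟨same_jlk, opp_ikl, hs.symm⟩

lemma splitColoring (h : CycEq A B) (hA : IsDense A) :
    SplitColoring (logEntry A) (SameCycles A B) where
  rotate := sameCycles_rotate A B
  swap := sameCycles_swap A B
  isSplit i j k l hk hl hne := by
    have rot := sameCycles_rotate A B
    have swap := sameCycles_swap A B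
    have r := @skew_rotate ι _ _ (logEntry A)
    have s := @skew_swap ι _ _ (logEntry A)
    have opp {u v w : ι} (hs : skew (logEntry A) u v w ≠ 0) := h.sameCycles_transpose_iff_not hA hs
    by_cases same_ijk : SameCycles A B i j k
    · have opp_ijl := (opp hl).2 (hne.1 same_ijk)
      rcases h.isSplit_or_isSplit hA hk hl same_ijk opp_ijl with ⟨h₁, h₂, hs⟩ | ⟨h₁, h₂, hs⟩
      all_goals grind [hs.skew_congr_right, hs.symm.skew_congr_right]
    · have same_ijl : SameCycles A B i j l := by tauto
      rcases h.isSplit_or_isSplit hA hl hk same_ijl ((opp hk).2 same_ijk) with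
        ⟨h₁, h₂, hs⟩ | ⟨h₁, h₂, hs⟩
      all_goals grind [hs.skew_congr_right, hs.symm.skew_congr_right, hs.symm]

end CycEq

end TripleColoring

section Similarity

open scoped Matrix

variable {ι F : Type*} [Field F] {A B : Matrix ι ι F}

lemma CycEq.ne_zero (h : CycEq A B) (hA : IsDense A) {i j : ι} (hij : i ≠ j) : B i j ≠ 0 :=
  left_ne_zero_of_mul (h.pair i j ▸ mul_ne_zero (hA i j hij) (hA j i hij.symm))

lemma CycEq.exists_diagonal_similarity (h : CycEq A B) (hA : IsDense A)
    (hcyc : ∀ i j k, cyc B i j k = cyc A i j k) :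
    ∃ d : ι → F, (∀ i, d i ≠ 0) ∧ ∀ i j, d i * B i j = A i j * d j := by
  classical
  rcases isEmpty_or_nonempty ι with _ | ⟨⟨o⟩⟩
  · exact ⟨0, isEmptyElim, isEmptyElim⟩
  let d (j : ι) : F := if o = j then 1 else B o j / A o j
  refine ⟨d, fun j => ?_, fun i j => ?_⟩
  · by_cases hj : o = j
    · simp only [d, if_pos hj, ne_eq, one_ne_zero, not_false_eq_true]
    · simpa only [d, if_neg hj] using div_ne_zero (h.ne_zero hA hj) (hA o j hj)
  by_cases hi : o = i <;> by_cases hj : o = j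
  · rw [← hi, ← hj, h.diag, mul_comm]
  · subst hi
    simp only [d, if_true, if_neg hj]
    field_simp [hA o j hj]
  · subst hj
    simp only [d, if_true, if_neg hi]
    field_simp [hA o i hi]
    linear_combination -h.pair o i
  · simp only [d, if_neg hi, if_neg hj]
    field_simp [hA o i hi, hA o j hj]
    refine mul_right_cancel₀ (h.ne_zero hA (Ne.symm hj)) ?_
    have := hcyc o i j
    unfold cyc at this
    linear_combination A o j * this + A o i * A i j * h.pair o j

variable [DecidableEq ι]

lemma pme_of_diagonal_similarity {d : ι → F} (hd : ∀ i, d i ≠ 0)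
    (h : ∀ i j, d i * B i j = A i j * d j) : PME A B := by
  intro S
  have hmul : Matrix.diagonal (fun i : S => d i) * sub B S S =
      sub A S S * Matrix.diagonal (fun i : S => d i) := by
    ext i j
    rw [Matrix.diagonal_mul, Matrix.mul_diagonal]
    exact h i j
  have hdet := congrArg Matrix.det hmul
  rw [Matrix.det_mul, Matrix.det_mul, Matrix.det_diagonal, mul_comm] at hdet
  exact (mul_right_cancel₀ (Finset.prod_ne_zero_iff.2 fun (i : S) _ => hd i) hdet).symm

lemma pme_transpose_right : PME A Bᵀ ↔ PME A B :=
  forall_congr' fun S => by rw [← Matrix.det_transpose (sub B S S)]; rfl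

lemma CycEq.pme_of_forall_sameCycles (h : CycEq A B) (hA : IsDense A)
    (hs : ∀ i j k, skew (logEntry A) i j k ≠ 0 → SameCycles A B i j k) : PME A B := by
  obtain ⟨d, hd, hAB⟩ := h.exists_diagonal_similarity hA fun i j k => by
    by_cases hijk : skew (logEntry A) i j k = 0
    · exact (h.sameCycles_of_skew_eq_zero hA hijk).1
    · exact (hs i j k hijk).1
  exact pme_of_diagonal_similarity hd hAB

end Similarity

end PrincipalMinors

open PrincipalMinors in
theorem theorem4p10_general {ι F : Type*} [Fintype ι] [DecidableEq ι] [Field F]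
    (A B : Matrix ι ι F) (hR : PropertyR A) (hcut : ¬ ∃ X : Finset ι, IsCut A X) :
    PME A B ↔ PMEUpTo 4 A B := by
  refine ⟨fun h S _ => h S, fun h => ?_⟩
  obtain ⟨hA, hR⟩ := hR
  have hAB := h.cycEq
  have hχ := hAB.splitColoring hA
  have not_mixed (i j k l : ι) : ¬MixedSplit (logEntry A) (SameCycles A B) i j k l :=
    fun hmixed => hcut (hmixed.exists_isCut hA hR hχ)
  by_cases hsame : ∀ i j k, skew (logEntry A) i j k ≠ 0 → SameCycles A B i j k
  · exact hAB.pme_of_forall_sameCycles hA hsame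
  · push Not at hsame
    obtain ⟨u, v, w, huvw, hopp⟩ := hsame
    refine pme_transpose_right.1 <| hAB.transpose.pme_of_forall_sameCycles hA
      fun i j k hijk => ?_
    rw [hAB.sameCycles_transpose_iff_not hA hijk,
      hχ.color_eq_of_forall_not_mixedSplit not_mixed hijk huvw]
    exact hopp

theorem theorem4p10 {F : Type*} [Field F] (n : ℕ) (A B : Matrix (Fin n) (Fin n) F)
    (hR : PrincipalMinors.PropertyR A)
    (hcut : ¬ ∃ X : Finset (Fin n), PrincipalMinors.IsCut A X) :
    PrincipalMinors.PME A B ↔ PrincipalMinors.PMEUpTo 4 A B :=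
  theorem4p10_general A B hR hcut
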